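/- Let $S$ be a monoid. For $F\subseteq S$ finite and non-empty and $s\in S$ put $Fs=\{fs: f\in F\}$. A \emph{right F\o lner net} of $S$ is a net $(F_i)_{i\in I}$ of non-empty finite subsets of $S$ such that $\lim_{i}|F_is\setminus F_i|/|F_i|=0$ for every $s\in S$. Let $\alpha$ be a left action of $S$ on an abelian group $A$, i.e. a monoid homomorphism $\alpha:S\to\mathrm{End}(A)$. For a non-empty finite subset $X$ of $A$ and a non-empty finite $F\subseteq S$ let $T_F(\alpha,X)=\sum_{s\in F}\alpha(s)(X)$ (sum of subsets of $A$), and let $$H_{alg}(\alpha,X)=\lim_{i}\frac{\log|T_{F_i}(\alpha,X)|}{|F_i|},$$ where $(F_i)_{i\in I}$ is a right F\o lner net of $S$, whenever right F\o lner nets exist and this limit exists and has the same value for all of them. Let $$h_{alg}(\alpha)=\sup\{H_{alg}(\alpha,X): X\subseteq A \text{ finite, non-empty}\},\qquad \mathrm{ent}(\alpha)=\sup\{H_{alg}(\alpha,B): B\le A\text{ a finite subgroup}\},$$ both in $[0,\infty]$. \textbf{Theorem.} Let $G$ be an amenable group (that is, there are finitely additive probability measures on all subsets of $G$ that are invariant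 under left, respectively right, translations), let $A$ be an abelian group, and let $\alpha$ be a left action of $G$ on $A$ by group endomorphisms. Let $N$ be a normal subgroup of $G$ with $N\subseteq\ker\alpha$, and let $\bar\alpha_{G/N}$ be the induced action of $G/N$ on $A$, given by $\bar\alpha_{G/N}(gN)=\alpha(g)$. Then $H_{alg}(\alpha,X)$ and $H_{alg}(\bar\alpha_{G/N},X)$ are well defined for every non-empty finite $X\subseteq A$ (right F\o lner nets of $G$ and of $G/N$ exist, and the limits exist as real numbers and do not depend on the net), and $$h_{alg}(\alpha)=\begin{cases}0&\text{if $N$ is infinite},\\ \dfrac{h_{alg}(\bar\alpha_{G/N})}{|N|}&\text{if $N$ is finite},\end{cases}\qquad \mathrm{ent}(\alpha)=\begin{cases}0&\text{if $N$ is infinite},\\ \dfrac{\mathrm{ent}(\bar\alpha_{G/N})}{|N|}&\text{if $N$ is finite},\end{cases}$$ where $\infty/|N|=\infty$. -/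

import Mathlib

open Filter Topology
open scoped Pointwise

noncomputable section

/-- A semigroup `S` is left amenable: there is a finitely additive probability measure on all
subsets of `S` which is invariant under preimages of left multiplications. -/
def IsLeftAmenable (S : Type*) [Semigroup S] : Prop :=
  ∃ μ : Set S → ℝ, (∀ E, 0 ≤ μ E ∧ μ E ≤ 1) ∧ μ Set.univ = 1 ∧
    (∀ E F : Set S, Disjoint E F → μ (E ∪ F) = μ E + μ F) ∧
    ∀ (s : S) (E : Set S), μ ((fun x => s * x) ⁻¹' E) = μ E

/-- A semigroup is right amenable if its opposite semigroup is left amenable. -/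
def IsRightAmenable (S : Type*) [Semigroup S] : Prop :=
  IsLeftAmenable Sᵐᵒᵖ

/-- A semigroup is amenable if it is both left and right amenable. -/
def IsAmenable (S : Type*) [Semigroup S] : Prop :=
  IsLeftAmenable S ∧ IsRightAmenable S

open Classical in
/-- The ratio `|F s \ F| / |F|`. -/
def folnerRatio {S : Type*} [Mul S] (s : S) (F : Finset S) : ℝ :=
  ((F.image (fun x => x * s) \ F).card : ℝ) / (F.card : ℝ)

/-- A right Følner net of `S`: a net of non-empty finite subsets of `S`, indexed by a directed set,
such that `|F i s \ F i| / |F i|` tends to `0` for every `s`. -/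
structure IsRightFolnerNet {S ι : Type*} [Mul S] [Preorder ι] (F : ι → Finset S) : Prop where
  index_nonempty : Nonempty ι
  index_directed : IsDirected ι (· ≤ ·)
  nonempty : ∀ i, (F i).Nonempty
  tendsto : ∀ s : S, Tendsto (fun i => folnerRatio s (F i)) atTop (𝓝 0)

/-- The filter on finite subsets of `S` that encodes all right Følner nets: a net of non-empty
finite subsets is a right Følner net if and only if it tends to this filter. -/
def rightFolner (S : Type*) [Mul S] : Filter (Finset S) :=
  𝓟 {F | F.Nonempty} ⊓ ⨅ s : S, comap (folnerRatio s) (𝓝 0)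

/-- A net, indexed by a directed set, is a right Følner net iff it consists of non-empty finite
sets and converges to the filter `rightFolner S`. -/
theorem isRightFolnerNet_iff {S ι : Type*} [Mul S] [Preorder ι] [Nonempty ι]
    [IsDirected ι (· ≤ ·)] (F : ι → Finset S) :
    IsRightFolnerNet F ↔ (∀ i, (F i).Nonempty) ∧ Tendsto F atTop (rightFolner S) := by
  constructor
  · intro h
    refine ⟨h.nonempty, ?_⟩
    refine tendsto_inf.2 ⟨tendsto_principal.2 (Eventually.of_forall h.nonempty), ?_⟩
    exact tendsto_iInf.2 fun s => tendsto_comap_iff.2 (h.tendsto s)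
  · rintro ⟨h, ht⟩
    refine ⟨inferInstance, inferInstance, h, fun s => ?_⟩
    exact tendsto_comap_iff.1 (tendsto_iInf.1 (tendsto_inf.1 ht).2 s)

section Entropy

variable {S : Type*} [Monoid S] {A : Type*} [AddCommGroup A]

/-- The trajectory `T_F(α, X) = ∑_{s ∈ F} α(s)(X)` (Minkowski sum of subsets of `A`). A left
action of `S` on `A` by endomorphisms is a monoid homomorphism `S →* AddMonoid.End A`. -/
def trajectory (α : S →* AddMonoid.End A) (F : Finset S) (X : Set A) : Set A :=
  ∑ s ∈ F, (fun a => α s a) '' X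

/-- The ratio `log |T_F(α, X)| / |F|`, for finite `X`. -/
def trajectoryRate (α : S →* AddMonoid.End A) (X : Set A) (F : Finset S) : ℝ :=
  Real.log ((trajectory α F X).ncard : ℝ) / (F.card : ℝ)

/-- `H_alg(α, X)`: the limit of `log |T_F(α, X)| / |F|` along right Følner nets. -/
def Halg (α : S →* AddMonoid.End A) (X : Set A) : ℝ :=
  limUnder (rightFolner S) (trajectoryRate α X)

/-- Right Følner sets exist, and for every non-empty finite `X ⊆ A` the ratios
`log |T_F(α, X)| / |F|` converge to `Halg α X` along all right Følner nets. -/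
def HalgWellDefined (α : S →* AddMonoid.End A) : Prop :=
  (rightFolner S).NeBot ∧ ∀ X : Set A, X.Finite → X.Nonempty →
    Tendsto (trajectoryRate α X) (rightFolner S) (𝓝 (Halg α X))

/-- The algebraic entropy: the supremum in `[0, ∞]` of `H_alg(α, X)`
over the non-empty finite subsets `X` of `A`. -/
def halg (α : S →* AddMonoid.End A) : ENNReal :=
  ⨆ (X : Set A) (_ : X.Finite) (_ : X.Nonempty), ENNReal.ofReal (Halg α X)

/-- The entropy `ent`: the supremum in `[0, ∞]` of `H_alg(α, B)`
over the finite subgroups `B` of `A`. -/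
def entAlg (α : S →* AddMonoid.End A) : ENNReal :=
  ⨆ (B : AddSubgroup A) (_ : (B : Set A).Finite), ENNReal.ofReal (Halg α (B : Set A))

end Entropy

/-- The quotient action of `G ⧸ N` on `A` induced by `α`, for `N ≤ ker α`. -/
def quotientAction {G A : Type*} [Group G] [AddCommGroup A] (α : G →* AddMonoid.End A)
    (N : Subgroup G) [N.Normal] (hN : N ≤ α.ker) : G ⧸ N →* AddMonoid.End A :=
  QuotientGroup.lift N α hN

end

/-! Everything rests on one fact: over a right amenable group `Halg α X` is the infimum of
`trajectoryRate α X K` over all non-empty finite `K`, not merely a limit. This gives existence and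
independence of the net at once, and it allows upper bounds from a single well-chosen `K`.

The infimum formula (`tendsto_trajectoryRate`) comes from a Shearer inequality for sumsets. The
translates `gK` with `g ∈ F * K⁻¹` cover each point of `F` exactly `|K|` times, so `|T_F| ^ |K| ≤
|T_K| ^ |F * K⁻¹|`; along a Følner net `|F * K⁻¹| / |F|` has upper limit at most 1. Følner nets
themselves come from right amenability: without almost invariant sets, Hall's theorem yields a
doubling map incompatible with an invariant mean.

If `N` is infinite, take `K ⊆ N` with `n` elements. It acts trivially, so `T_K` is an `n`-fold
sumset of `X`, of size at most `(n + 1) ^ |X|`, and the rate tends to 0.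

If `N` is finite, preimages of Følner sets of `G ⧸ N` are Følner in `G`, and each coset contributes
`|N|` equal summands. Hence `Halg α X` is the value of the quotient action at the `|N|`-fold sumset
of `X`, divided by `|N|`. Passing to sumsets does not change the supremum over finite sets, and it
fixes every subgroup. -/

/-! ### Amenability and Følner sets. -/

/-- Right amenability passes to homomorphic images. -/
theorem IsRightAmenable.of_surjective {G H : Type*} [Group G] [Group H]
    (hG : IsRightAmenable G) (f : G →* H) (hf : Function.Surjective f) : IsRightAmenable H := by
  obtain ⟨μ, h01, huniv, hadd, hinv⟩ := hG
  refine ⟨fun E => μ ((MonoidHom.op f) ⁻¹' E), fun E => h01 _, huniv, fun E F hEF => ?_,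
    fun s E => ?_⟩
  · exact hadd _ _ (hEF.preimage _)
  · obtain ⟨g, hg⟩ := hf s.unop
    have := hinv (MulOpposite.op g) ((MonoidHom.op f) ⁻¹' E)
    refine Eq.trans (congrArg μ ?_) this
    ext x
    have : s = MulOpposite.op (f g) := by rw [hg]; rfl
    simp [this]

/-- A finitely additive set function sums over finite disjoint unions. -/
theorem finitelyAdditive_biUnion {α ι : Type*} (μ : Set α → ℝ)
    (hadd : ∀ E F : Set α, Disjoint E F → μ (E ∪ F) = μ E + μ F) (s : Finset ι) (C : ι → Set α)
    (hC : (s : Set ι).PairwiseDisjoint C) : μ (⋃ i ∈ s, C i) = ∑ i ∈ s, μ (C i) := by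
  classical
  have h0 : μ ∅ = 0 := by
    have := hadd ∅ ∅ (by simp)
    simpa using this
  induction s using Finset.induction_on with
  | empty => simpa using h0
  | insert a s ha ih =>
    rw [Finset.set_biUnion_insert, Finset.sum_insert ha, hadd, ih]
    · exact hC.subset (by simp)
    · simp only [Set.disjoint_iUnion_right]
      intro i hi
      exact hC (by simp) (by simp [hi]) (by rintro rfl; exact ha hi)

/-- A right amenable group admits no injective doubling map with bounded right displacement. -/
theorem IsRightAmenable.not_injective_double {G : Type*} [Group G] (hG : IsRightAmenable G)
    (L : Finset G) (f : G × Bool → G) (hf : Function.Injective f)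
    (hL : ∀ g b, g⁻¹ * f (g, b) ∈ L) : False := by
  classical
  obtain ⟨μ', h01, huniv, hadd', hinv'⟩ := hG
  set μ : Set G → ℝ := fun E => μ' (MulOpposite.unop ⁻¹' E) with hμ
  have hadd : ∀ E F : Set G, Disjoint E F → μ (E ∪ F) = μ E + μ F := fun E F h =>
    hadd' _ _ (h.preimage _)
  have hinv : ∀ (s : G) (E : Set G), μ ((fun x => x * s) ⁻¹' E) = μ E := fun s E =>
    hinv' (MulOpposite.op s) (MulOpposite.unop ⁻¹' E)
  have huniv' : μ Set.univ = 1 := huniv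
  -- For fixed `b`, the sets `B k b` with `k ∈ L` partition `G` according to the displacement of `f
  -- (·, b)`, so their measures add up to 1.
  let B : G → Bool → Set G := fun k b => {g | f (g, b) = g * k}
  have hB : ∀ b, ∑ k ∈ L, μ (B k b) = 1 := by
    intro b
    rw [← finitelyAdditive_biUnion μ hadd L (fun k => B k b), ← huniv']
    · congr 1
      ext g
      simp only [Set.mem_iUnion, Set.mem_univ, iff_true]
      exact ⟨_, hL g b, by simp [B]⟩
    · intro k _ l _ hkl
      refine Set.disjoint_left.2 fun g hk hl => hkl ?_
      exact mul_left_cancel (Eq.trans (Eq.symm hk) hl)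
  -- `C (k, b)` is the translate `B k b * k`, that is, the image of `B k b × {b}` under `f`.
  -- Injectivity makes these sets disjoint and invariance preserves their measures, so a total of 2
  -- fits into measure 1.
  let C : G × Bool → Set G := fun p => (fun x => x * p.1⁻¹) ⁻¹' B p.1 p.2
  have hC : ∑ p ∈ L ×ˢ (Finset.univ : Finset Bool), μ (C p) ≤ 1 := by
    rw [← finitelyAdditive_biUnion μ hadd]
    · exact (h01 _).2
    · intro p _ q _ hpq
      refine Set.disjoint_left.2 fun h hp hq => hpq ?_
      simp only [C, B, Set.mem_preimage, Set.mem_ofPred_eq, inv_mul_cancel_right] at hp hq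
      have := hf (hp.trans hq.symm)
      simp only [Prod.mk.injEq, mul_right_inj, inv_inj] at this
      exact Prod.ext this.1 this.2
  have : ∑ p ∈ L ×ˢ (Finset.univ : Finset Bool), μ (C p) = 2 := by
    simp only [C, hinv]
    rw [Finset.sum_product_right]
    simp [hB]
  linarith

open Classical in
/-- Finite sets in a right amenable group that are almost invariant under finitely many right
translations. -/
theorem IsRightAmenable.exists_folnerRatio_le {G : Type*} [Group G] (hG : IsRightAmenable G)
    (K : Finset G) {ε : ℝ} (hε : 0 < ε) :
    ∃ F : Finset G, F.Nonempty ∧ ∀ s ∈ K, folnerRatio s F ≤ ε := by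
  by_contra! hcon
  -- Since `1 ∈ M`, the product `F * M` contains `F` as well as every `F * s`. A failure of almost
  -- invariance thus makes every finite set grow by the factor `1 + ε`, and a power of `M` doubles
  -- all finite sets.
  set M := insert 1 K with hM
  have hgrow : ∀ F : Finset G, (1 + ε) * (F.card : ℝ) ≤ ((F * M).card : ℝ) := by
    intro F
    rcases F.eq_empty_or_nonempty with rfl | hF
    · simp
    obtain ⟨s, hs, hlt⟩ := hcon F hF
    have hpos : (0 : ℝ) < F.card := by exact_mod_cast hF.card_pos
    rw [folnerRatio, lt_div_iff₀ hpos] at hlt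
    have hsub : F ∪ (F.image (fun x => x * s) \ F) ⊆ F * M := by
      refine Finset.union_subset (fun x hx => ?_) (fun x hx => ?_)
      · simpa using Finset.mul_mem_mul hx (Finset.mem_insert_self 1 K)
      · obtain ⟨y, hy, rfl⟩ := Finset.mem_image.1 (Finset.mem_sdiff.1 hx).1
        exact Finset.mul_mem_mul hy (Finset.mem_insert_of_mem hs)
    have hle := Finset.card_le_card hsub
    rw [Finset.card_union_of_disjoint Finset.disjoint_sdiff] at hle
    have : (F.card : ℝ) + ((F.image (fun x => x * s) \ F).card : ℝ) ≤ ((F * M).card : ℝ) := by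
      exact_mod_cast hle
    linarith
  have hpow : ∀ (n : ℕ) (F : Finset G), (1 + ε) ^ n * (F.card : ℝ) ≤ ((F * M ^ n).card : ℝ) := by
    intro n
    induction n with
    | zero => simp
    | succ n ih =>
      intro F
      have h1 := hgrow (F * M ^ n)
      have h2 := mul_le_mul_of_nonneg_left (ih F) (by linarith : 0 ≤ 1 + ε)
      rw [pow_succ M, ← mul_assoc, pow_succ' (1 + ε), mul_assoc]
      exact h2.trans h1
  obtain ⟨n, hn⟩ := pow_unbounded_of_one_lt 2 (by linarith : 1 < 1 + ε)
  set L := M ^ n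
  have hdouble : ∀ F : Finset G, 2 * F.card ≤ (F * L).card := by
    intro F
    have h1 := hpow n F
    have h2 : (2 : ℝ) * F.card ≤ (1 + ε) ^ n * F.card := by gcongr
    exact_mod_cast h2.trans h1
  -- Hall's marriage theorem: doubling of the projection to `G` is Hall's condition for the two
  -- copies of each `g` to choose distinct points of `g * L`.
  obtain ⟨f, hf, hfL⟩ := (Finset.all_card_le_biUnion_card_iff_exists_injective
    (fun p : G × Bool => L.image (fun k => p.1 * k))).1 (by
      intro s
      have h1 : s ⊆ s.image Prod.fst ×ˢ (Finset.univ : Finset Bool) := fun p hp => by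
        exact Finset.mem_product.2 ⟨Finset.mem_image_of_mem _ hp, Finset.mem_univ _⟩
      have h2 := Finset.card_le_card h1
      rw [Finset.card_product, Finset.card_univ, Fintype.card_bool] at h2
      have h3 : s.image Prod.fst * L ⊆ s.biUnion fun p => L.image (fun k => p.1 * k) := by
        intro x hx
        obtain ⟨g, hg, k, hk, rfl⟩ := Finset.mem_mul.1 hx
        obtain ⟨p, hp, rfl⟩ := Finset.mem_image.1 hg
        exact Finset.mem_biUnion.2 ⟨p, hp, Finset.mem_image_of_mem _ hk⟩
      have h4 := Finset.card_le_card h3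
      have h5 := hdouble (s.image Prod.fst)
      omega)
  refine hG.not_injective_double L f hf fun g b => ?_
  obtain ⟨k, hk, hkf⟩ := Finset.mem_image.1 (hfL (g, b))
  rw [← hkf]
  simpa using hk

theorem folnerRatio_nonneg {S : Type*} [Mul S] (s : S) (F : Finset S) : 0 ≤ folnerRatio s F := by
  unfold folnerRatio
  positivity

/-- **Følner's theorem**: right amenable groups have right Følner nets. -/
theorem IsRightAmenable.rightFolner_neBot {G : Type*} [Group G] (hG : IsRightAmenable G) :
    (rightFolner G).NeBot := by
  classical
  have h : ∀ p : Finset G × ℕ, ∃ F : Finset G, F.Nonempty ∧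
      ∀ s ∈ p.1, folnerRatio s F ≤ 1 / ((p.2 : ℝ) + 1) := fun p =>
    hG.exists_folnerRatio_le p.1 (by positivity)
  choose F hF hFs using h
  have hnet : IsRightFolnerNet F := by
    refine ⟨inferInstance, inferInstance, hF, fun s => ?_⟩
    have hlim : Tendsto (fun p : Finset G × ℕ => 1 / ((p.2 : ℝ) + 1)) atTop (𝓝 0) := by
      rw [← prod_atTop_atTop_eq]
      exact tendsto_one_div_add_atTop_nhds_zero_nat.comp tendsto_snd
    refine tendsto_of_tendsto_of_tendsto_of_le_of_le' tendsto_const_nhds hlim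
      (Eventually.of_forall fun p => folnerRatio_nonneg _ _) ?_
    filter_upwards [eventually_ge_atTop (({s} : Finset G), 0)] with p hp
    exact hFs p s (hp.1 (by simp))
  exact ((isRightFolnerNet_iff F).1 hnet).2.neBot

/-! ### Shearer's inequality for projections and for sumsets. -/

/-- The numerical step in the induction for Shearer's inequality: generalized Hölder with `k` equal
exponents. -/
theorem sum_pow_le_prod_of_pow_le_prod {β J : Type*} (V : Finset β) (s : Finset J)
    (p : J → Prop) [DecidablePred p] (k : ℕ) (hk : (s.filter p).card = k) (hk0 : k ≠ 0)
    (n : β → ℝ) (q : J → β → ℝ) (Q : J → ℝ) (hn : ∀ a ∈ V, 0 ≤ n a)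
    (hq : ∀ j ∈ s, ∀ a ∈ V, 0 ≤ q j a) (hQ : ∀ j ∈ s, 0 < Q j)
    (hqQ : ∀ j ∈ s, ∀ a ∈ V, q j a ≤ Q j)
    (hsum : ∀ j ∈ s, p j → ∑ a ∈ V, q j a ≤ Q j)
    (hnq : ∀ a ∈ V, n a ^ k ≤ ∏ j ∈ s, q j a) :
    (∑ a ∈ V, n a) ^ k ≤ ∏ j ∈ s, Q j := by
  have hkpos : (0 : ℝ) < k := by exact_mod_cast Nat.pos_of_ne_zero hk0
  set P : ℝ := ∏ j ∈ s, Q j with hP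
  have hPpos : 0 < P := Finset.prod_pos hQ
  set R : ℝ := P ^ ((k : ℝ)⁻¹) with hR
  have hRpos : 0 < R := Real.rpow_pos_of_pos hPpos _
  have hRk : R ^ k = P := Real.rpow_inv_natCast_pow hPpos.le hk0
  -- After normalising, all ratios `q j a / Q j` are at most 1, so the factors with `¬ p j` can be
  -- dropped. Weighted AM-GM applies to the remaining `k` factors, and summing over `a` uses `hsum`.
  have key : ∀ a ∈ V, n a / R ≤ ∑ j ∈ s.filter p, (k : ℝ)⁻¹ * (q j a / Q j) := by
    intro a ha
    have hr0 : ∀ j ∈ s, 0 ≤ q j a / Q j := fun j hj => div_nonneg (hq j hj a ha) (hQ j hj).le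
    have hr1 : ∀ j ∈ s, q j a / Q j ≤ 1 := fun j hj =>
      (div_le_one (hQ j hj)).2 (hqQ j hj a ha)
    have h1 : (n a / R) ^ k ≤ ∏ j ∈ s.filter p, q j a / Q j := by
      rw [div_pow, hRk]
      calc n a ^ k / P ≤ (∏ j ∈ s, q j a) / P := by gcongr; exact hnq a ha
        _ = ∏ j ∈ s, q j a / Q j := (Finset.prod_div_distrib ..).symm
        _ ≤ ∏ j ∈ s.filter p, q j a / Q j := by
          rw [← Finset.prod_filter_mul_prod_filter_not s p]
          refine mul_le_of_le_one_right
            (Finset.prod_nonneg fun j hj => hr0 j (Finset.mem_filter.1 hj).1) ?_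
          exact Finset.prod_le_one (fun j hj => hr0 j (Finset.mem_filter.1 hj).1)
            (fun j hj => hr1 j (Finset.mem_filter.1 hj).1)
    have h2 := Real.geom_mean_le_arith_mean_weighted (s.filter p) (fun _ => (k : ℝ)⁻¹)
      (fun j => q j a / Q j) (fun _ _ => by positivity)
      (by rw [Finset.sum_const, hk, nsmul_eq_mul, mul_inv_cancel₀ hkpos.ne'])
      (fun j hj => hr0 j (Finset.mem_filter.1 hj).1)
    refine le_trans ?_ h2
    rw [Real.finsetProd_rpow _ _ (fun j hj => hr0 j (Finset.mem_filter.1 hj).1)]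
    have h3 : n a / R = ((n a / R) ^ k) ^ ((k : ℝ)⁻¹) :=
      (Real.pow_rpow_inv_natCast (div_nonneg (hn a ha) hRpos.le) hk0).symm
    rw [h3]
    exact Real.rpow_le_rpow (pow_nonneg (div_nonneg (hn a ha) hRpos.le) _) h1 (by positivity)
  have hle : (∑ a ∈ V, n a) / R ≤ 1 := by
    rw [Finset.sum_div]
    refine (Finset.sum_le_sum key).trans ?_
    rw [Finset.sum_comm]
    calc ∑ j ∈ s.filter p, ∑ a ∈ V, (k : ℝ)⁻¹ * (q j a / Q j)
        ≤ ∑ j ∈ s.filter p, (k : ℝ)⁻¹ := by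
          refine Finset.sum_le_sum fun j hj => ?_
          obtain ⟨hj, hpj⟩ := Finset.mem_filter.1 hj
          rw [← Finset.mul_sum, ← Finset.sum_div]
          exact mul_le_of_le_one_right (by positivity) ((div_le_one (hQ j hj)).2 (hsum j hj hpj))
      _ = 1 := by rw [Finset.sum_const, hk, nsmul_eq_mul, mul_inv_cancel₀ hkpos.ne']
  rw [div_le_one hRpos] at hle
  rw [← hRk]
  exact pow_le_pow_left₀ (Finset.sum_nonneg hn) hle k

open Classical in
/-- **Shearer's inequality** for a finite set of functions; the projection to the coordinates in `I`
is encoded by replacing all other coordinates by zero. -/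
theorem shearer {ι A J : Type*} [Zero A] (s : Finset J) (I : J → Finset ι) (k : ℕ) (hk0 : k ≠ 0)
    (F : Finset ι) (hcov : ∀ i ∈ F, (s.filter fun j => i ∈ I j).card = k)
    (S : Finset (ι → A)) (hS : S.Nonempty) :
    (S.image ((F : Set ι).indicator)).card ^ k ≤
      ∏ j ∈ s, (S.image ((I j : Set ι).indicator)).card := by
  induction F using Finset.induction_on generalizing S with
  | empty =>
    have h1 : (S.image ((∅ : Finset ι) : Set ι).indicator).card ≤ 1 := by
      refine Finset.card_le_one.2 ?_
      simp
    calc _ ≤ 1 ^ k := Nat.pow_le_pow_left h1 k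
      _ = 1 := one_pow k
      _ ≤ _ := Nat.one_le_iff_ne_zero.2
          (Finset.prod_ne_zero_iff.2 fun j _ => (hS.image _).card_pos.ne')
  | insert i F hi ih =>
    -- The induction slices `S` by the value `a` of the new coordinate `i`: projections that see `i`
    -- split as a disjoint union over the slices, while the others are only bounded by monotonicity.
    have hfib : ∀ I : Finset ι, i ∈ I → (S.image ((I : Set ι).indicator)).card =
        ∑ a ∈ S.image (fun x => x i),
          ((S.filter fun x => x i = a).image ((I : Set ι).indicator)).card := by
      intro I hiI
      have : S.image ((I : Set ι).indicator) = (S.image (fun x => x i)).biUnion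
          fun a => (S.filter fun x => x i = a).image ((I : Set ι).indicator) := by
        ext y
        simp only [Finset.mem_image, Finset.mem_biUnion, Finset.mem_filter]
        constructor
        · rintro ⟨x, hx, rfl⟩
          exact ⟨x i, ⟨x, hx, rfl⟩, x, ⟨hx, rfl⟩, rfl⟩
        · rintro ⟨_, _, x, ⟨hx, _⟩, rfl⟩
          exact ⟨x, hx, rfl⟩
      rw [this, Finset.card_biUnion]
      intro a _ b _ hab
      refine Finset.disjoint_left.2 fun y hya hyb => hab ?_
      simp only [Finset.mem_image, Finset.mem_filter] at hya hyb
      obtain ⟨x, ⟨_, rfl⟩, rfl⟩ := hya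
      obtain ⟨z, ⟨_, rfl⟩, hz⟩ := hyb
      have := congrFun hz i
      simpa [hiI] using this.symm
    -- On a slice the coordinate `i` is constant, so forgetting it loses nothing: `Function.update`
    -- restores it.
    have hfibF : ∀ a ∈ S.image (fun x => x i),
        ((S.filter fun x => x i = a).image (((insert i F : Finset ι) : Set ι).indicator)).card ≤
        ((S.filter fun x => x i = a).image ((F : Set ι).indicator)).card := by
      intro a _
      refine Finset.card_le_card_of_surjOn (fun y => Function.update y i a) ?_
      intro y hy
      obtain ⟨x, hx, rfl⟩ := Finset.mem_image.1 (Finset.mem_coe.1 hy)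
      refine ⟨_, Finset.mem_coe.2 (Finset.mem_image_of_mem _ hx), ?_⟩
      have hxa := (Finset.mem_filter.1 hx).2
      ext l
      by_cases hl : l = i
      · subst hl; simp [hxa]
      · simp [Set.indicator_apply, hl]
    have hstep := sum_pow_le_prod_of_pow_le_prod (S.image (fun x => x i)) s (fun j => i ∈ I j) k
      (hcov i (by simp)) hk0
      (fun a => (((S.filter fun x => x i = a).image ((F : Set ι).indicator)).card : ℝ))
      (fun j a => (((S.filter fun x => x i = a).image ((I j : Set ι).indicator)).card : ℝ))
      (fun j => ((S.image ((I j : Set ι).indicator)).card : ℝ))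
      (fun _ _ => by positivity) (fun _ _ _ _ => by positivity)
      (fun j _ => by exact_mod_cast (hS.image _).card_pos)
      (fun j _ a _ => by
        exact_mod_cast Finset.card_le_card (Finset.image_subset_image (Finset.filter_subset _ _)))
      (fun j _ hj => by rw [hfib (I j) hj]; push_cast; exact le_rfl)
      (fun a ha => by
        obtain ⟨x, hx, hxa⟩ := Finset.mem_image.1 ha
        exact_mod_cast ih (fun l hl => hcov l (by simp [hl])) (S.filter fun x => x i = a)
          ⟨x, by simp [hx, hxa]⟩)
    rw [hfib _ (Finset.mem_insert_self i F)]
    refine (Nat.pow_le_pow_left (Finset.sum_le_sum hfibF) k).trans ?_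
    exact_mod_cast hstep

theorem mem_sumset {ι A : Type*} [AddCommGroup A] [DecidableEq A] (F : Finset ι)
    (Y : ι → Finset A) (t : A) :
    t ∈ ∑ i ∈ F, Y i ↔ ∃ (g : ι → A) (_ : ∀ {i}, i ∈ F → g i ∈ Y i), ∑ i ∈ F, g i = t := by
  rw [← Finset.mem_coe, Finset.coe_sum, Set.mem_finsetSum]
  rfl

open Classical in
/-- A finite sumset has a system of representatives such that all partial sums are determined
injectively. -/
theorem exists_representatives {ι A : Type*} [AddCommGroup A] (F : Finset ι) (Y : ι → Finset A) :
    ∃ S : Finset (ι → A), (∀ x ∈ S, ∀ i ∈ F, x i ∈ Y i) ∧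
      (∀ t ∈ ∑ i ∈ F, Y i, ∃ x ∈ S, ∑ i ∈ F, x i = t) ∧
      ∀ I ⊆ F, ∀ x ∈ S, ∀ y ∈ S, ∑ i ∈ I, x i = ∑ i ∈ I, y i → ∀ i ∈ I, x i = y i := by
  -- Each pair (index, value) gets its own power of 2, and each sum `t` is represented by a tuple of
  -- least total weight.
  obtain ⟨e, he⟩ := Set.countable_iff_exists_injOn.1
    (Finset.countable_toSet (F ×ˢ F.biUnion Y))
  let w : Finset ι → (ι → A) → ℕ := fun I x => ∑ i ∈ I, 2 ^ e (i, x i)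
  have hmin : ∀ t : A, t ∈ ∑ i ∈ F, Y i → ∃ x : ι → A, (∀ i ∈ F, x i ∈ Y i) ∧
      ∑ i ∈ F, x i = t ∧
      ∀ y : ι → A, (∀ i ∈ F, y i ∈ Y i) → ∑ i ∈ F, y i = t → w F x ≤ w F y := by
    intro t ht
    have hne : {x : ι → A | (∀ i ∈ F, x i ∈ Y i) ∧ ∑ i ∈ F, x i = t}.Nonempty := by
      obtain ⟨g, hg, hgt⟩ := (mem_sumset ..).1 ht
      exact ⟨g, fun i hi => hg hi, hgt⟩
    obtain ⟨x, hx, hxmin⟩ := WellFounded.has_min (measure (w F)).wf _ hne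
    exact ⟨x, hx.1, hx.2, fun y hy hyt => not_lt.1 (hxmin y ⟨hy, hyt⟩)⟩
  choose! r hrY hrt hrmin using hmin
  refine ⟨(∑ i ∈ F, Y i).image r, ?_, fun t ht => ⟨r t, Finset.mem_image_of_mem _ ht, hrt t ht⟩, ?_⟩
  · intro x hx
    obtain ⟨t, ht, rfl⟩ := Finset.mem_image.1 hx
    exact hrY t ht
  have hswap : ∀ I ⊆ F, ∀ t ∈ ∑ i ∈ F, Y i, ∀ u ∈ ∑ i ∈ F, Y i,
      ∑ i ∈ I, r t i = ∑ i ∈ I, r u i → w I (r t) ≤ w I (r u) := by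
    intro I hI t ht u hu htu
    -- Replacing `r t` by `r u` on `I` keeps the total sum `t`, so minimality compares the weights
    -- on `I`. By symmetry these weights coincide.
    have h := hrmin t ht (I.piecewise (r u) (r t))
      (fun i hi => by
        by_cases hiI : i ∈ I
        · simpa [hiI] using hrY u hu i hi
        · simpa [hiI] using hrY t ht i hi)
      (by
        rw [Finset.sum_piecewise, Finset.inter_eq_right.2 hI, ← htu, add_comm,
          Finset.sum_sdiff hI, hrt t ht])
    have hsplit : ∀ z : ι → A, w F z = w (F \ I) z + w I z := fun z =>
      (Finset.sum_sdiff hI).symm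
    rw [hsplit, hsplit] at h
    have h1 : w (F \ I) (I.piecewise (r u) (r t)) = w (F \ I) (r t) :=
      Finset.sum_congr rfl fun i hi => by simp [(Finset.mem_sdiff.1 hi).2]
    have h2 : w I (I.piecewise (r u) (r t)) = w I (r u) :=
      Finset.sum_congr rfl fun i hi => by simp [hi]
    omega
  intro I hI x hx y hy hxy i hi
  obtain ⟨t, ht, rfl⟩ := Finset.mem_image.1 hx
  obtain ⟨u, hu, rfl⟩ := Finset.mem_image.1 hy
  have hw : w I (r t) = w I (r u) :=
    le_antisymm (hswap I hI t ht u hu hxy) (hswap I hI u hu t ht hxy.symm)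
  have hmem : ∀ t ∈ ∑ i ∈ F, Y i, ∀ i ∈ I, (i, r t i) ∈ ((F ×ˢ F.biUnion Y : Finset _) : Set (ι × A)) := by
    intro t ht i hi
    simp only [Finset.coe_product, Set.mem_prod, Finset.mem_coe, Finset.mem_biUnion]
    exact ⟨hI hi, i, hI hi, hrY t ht i (hI hi)⟩
  have himg : ∀ t ∈ ∑ i ∈ F, Y i,
      w I (r t) = ∑ m ∈ I.image (fun i => e (i, r t i)), 2 ^ m := by
    intro t ht
    rw [Finset.sum_image]
    intro a ha b hb hab
    exact congrArg Prod.fst (he (hmem t ht a ha) (hmem t ht b hb) hab)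
  rw [himg t ht, himg u hu] at hw
  -- Uniqueness of binary expansions: equal weights on `I` mean equal sets of pairs (index, value),
  -- so the two tuples agree on `I`.
  have hinj := Finset.geomSum_injective le_rfl hw
  have hm : e (i, r t i) ∈ I.image (fun i => e (i, r u i)) :=
    hinj ▸ Finset.mem_image_of_mem (fun i => e (i, r t i)) hi
  obtain ⟨l, hl, hle⟩ := Finset.mem_image.1 hm
  have := he (hmem u hu l hl) (hmem t ht i hi) hle
  simp only [Prod.mk.injEq] at this
  obtain ⟨rfl, h⟩ := this
  exact h.symm

open Classical in
/-- Shearer's inequality for cardinalities of sumsets. -/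
theorem card_sum_pow_le_prod_card_sum {ι A J : Type*} [AddCommGroup A] (F : Finset ι)
    (Y : ι → Finset A) (hY : ∀ i ∈ F, (Y i).Nonempty) (s : Finset J) (I : J → Finset ι)
    (hI : ∀ j ∈ s, I j ⊆ F) (k : ℕ) (hk0 : k ≠ 0)
    (hcov : ∀ i ∈ F, (s.filter fun j => i ∈ I j).card = k) :
    (∑ i ∈ F, Y i).card ^ k ≤ ∏ j ∈ s, (∑ i ∈ I j, Y i).card := by
  obtain ⟨S, hSY, hSsurj, hSinj⟩ := exists_representatives F Y
  have hsumind : ∀ (I : Finset ι) (x : ι → A),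
      ∑ i ∈ I, (I : Set ι).indicator x i = ∑ i ∈ I, x i := fun I x =>
    Finset.sum_congr rfl fun i hi => by simp [hi]
  have hne : (∑ i ∈ F, Y i).Nonempty := by
    choose! y hy using hY
    exact ⟨∑ i ∈ F, y i, (mem_sumset ..).2 ⟨y, fun {i} hi => hy i hi, rfl⟩⟩
  have hS : S.Nonempty := by
    obtain ⟨t, ht⟩ := hne
    obtain ⟨x, hx, _⟩ := hSsurj t ht
    exact ⟨x, hx⟩
  -- On `F` the representatives surject onto the sumset; on each `I j` summation is injective on
  -- projected representatives. The two bounds therefore go in the directions that Shearer's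
  -- inequality needs.
  have h1 : (∑ i ∈ F, Y i).card ≤ (S.image ((F : Set ι).indicator)).card := by
    refine Finset.card_le_card_of_surjOn (fun x => ∑ i ∈ F, x i) fun t ht => ?_
    obtain ⟨x, hx, hxt⟩ := hSsurj t ht
    exact ⟨_, Finset.mem_coe.2 (Finset.mem_image_of_mem _ hx), (hsumind F x).trans hxt⟩
  refine (Nat.pow_le_pow_left h1 k).trans ((shearer s I k hk0 F hcov S hS).trans ?_)
  refine Finset.prod_le_prod' fun j hj => ?_
  refine Finset.card_le_card_of_injOn (fun x => ∑ i ∈ I j, x i) ?_ ?_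
  · intro y hy
    obtain ⟨x, hx, rfl⟩ := Finset.mem_image.1 (Finset.mem_coe.1 hy)
    simp only [hsumind]
    exact (mem_sumset ..).2 ⟨x, fun {i} hi => hSY x hx i (hI j hj hi), rfl⟩
  · intro y hy z hz hyz
    obtain ⟨x, hx, rfl⟩ := Finset.mem_image.1 (Finset.mem_coe.1 hy)
    obtain ⟨x', hx', rfl⟩ := Finset.mem_image.1 (Finset.mem_coe.1 hz)
    simp only [hsumind] at hyz
    have := hSinj (I j) (hI j hj) x hx x' hx' hyz
    ext i
    by_cases hi : i ∈ I j
    · simp [hi, this i hi]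
    · simp [hi]

/-! ### Trajectories and convergence of the rates to their infimum. -/

section Trajectory

variable {S : Type*} [Monoid S] {A : Type*} [AddCommGroup A] (α : S →* AddMonoid.End A)

theorem trajectory_finite {X : Set A} (hX : X.Finite) (F : Finset S) :
    (trajectory α F X).Finite := by
  classical
  lift X to Finset A using hX
  have : trajectory α F (X : Set A) = ((∑ s ∈ F, X.image (α s) : Finset A) : Set A) := by
    simp [trajectory]
  rw [this]
  exact Finset.finite_toSet _

theorem trajectory_nonempty {X : Set A} (hX : X.Nonempty) (F : Finset S) :
    (trajectory α F X).Nonempty := by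
  obtain ⟨x, hx⟩ := hX
  exact ⟨∑ s ∈ F, α s x, (Set.mem_finsetSum ..).2
    ⟨fun s => α s x, fun _ => Set.mem_image_of_mem _ hx, rfl⟩⟩

theorem trajectory_ncard_pos {X : Set A} (hX : X.Finite) (hX' : X.Nonempty) (F : Finset S) :
    0 < (trajectory α F X).ncard :=
  (Set.ncard_pos (trajectory_finite α hX F)).2 (trajectory_nonempty α hX' F)

theorem trajectoryRate_nonneg (X : Set A) (F : Finset S) : 0 ≤ trajectoryRate α X F :=
  div_nonneg (Real.log_natCast_nonneg _) (Nat.cast_nonneg _)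

theorem Set.ncard_le_ncard_add {X Y : Set A} (hX : X.Finite) (hY : Y.Finite) (hY' : Y.Nonempty) :
    X.ncard ≤ (X + Y).ncard := by
  obtain ⟨y, hy⟩ := hY'
  exact Set.ncard_le_ncard_of_injOn (fun x => x + y) (fun x hx => Set.add_mem_add hx hy)
    ((add_left_injective y).injOn) (hX.add hY)

theorem trajectory_ncard_mono {X : Set A} (hX : X.Finite) (hX' : X.Nonempty) {F F' : Finset S}
    (h : F ⊆ F') : (trajectory α F X).ncard ≤ (trajectory α F' X).ncard := by
  classical
  have : trajectory α F' X = trajectory α F X + trajectory α (F' \ F) X := by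
    rw [add_comm]
    exact (Finset.sum_sdiff h).symm
  rw [this]
  exact Set.ncard_le_ncard_add (trajectory_finite α hX _) (trajectory_finite α hX _)
    (trajectory_nonempty α hX' _)

end Trajectory

section Group

variable {G : Type*} [Group G] {A : Type*} [AddCommGroup A] (α : G →* AddMonoid.End A)

open Classical in
-- Since `α (g * k) = α g ∘ α k` and `α g` is additive, the trajectory over `gK` is the image of the
-- trajectory over `K` under `α g`.
theorem trajectory_translate_ncard_le {X : Set A} (hX : X.Finite) (K : Finset G) (g : G) :
    (trajectory α (K.image fun k => g * k) X).ncard ≤ (trajectory α K X).ncard := by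
  have : trajectory α (K.image fun k => g * k) X = (α g) '' trajectory α K X := by
    rw [trajectory, trajectory, Finset.sum_image (fun a _ b _ h => mul_left_cancel h),
      Set.image_finsetSum]
    refine Finset.sum_congr rfl fun k _ => ?_
    rw [Set.image_image]
    simp
  rw [this]
  exact Set.ncard_image_le (trajectory_finite α hX K)

open Classical in
/-- Covering `F` by translates of `K` bounds the size of the trajectory over `F`. -/
theorem trajectory_ncard_pow_le {X : Set A} (hX : X.Finite) (hX' : X.Nonempty)
    (F K : Finset G) (hK : K.Nonempty) :
    (trajectory α F X).ncard ^ K.card ≤ (trajectory α K X).ncard ^ (F * K⁻¹).card := by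
  have htraj : ∀ F : Finset G, (trajectory α F X).ncard =
      (∑ s ∈ F, hX.toFinset.image (α s) : Finset A).card := by
    intro F
    rw [← Set.ncard_coe_finset]
    congr 1
    simp [trajectory]
  have h := card_sum_pow_le_prod_card_sum F (fun s => hX.toFinset.image (α s))
    (fun s _ => ((Set.Finite.toFinset_nonempty hX).2 hX').image _) (F * K⁻¹)
    (fun g => F ∩ K.image fun k => g * k) (fun _ _ => Finset.inter_subset_left)
    K.card hK.card_pos.ne' (by
      intro i hi
      -- A point `i` lies in `gK` exactly when `g = i * k⁻¹` for some `k ∈ K`, which gives the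
      -- constant multiplicity `|K|`.
      have : ((F * K⁻¹).filter fun g => i ∈ F ∩ K.image fun k => g * k) =
          K.image fun k => i * k⁻¹ := by
        ext g
        simp only [Finset.mem_filter, Finset.mem_inter, Finset.mem_image]
        constructor
        · rintro ⟨_, _, k, hk, rfl⟩
          exact ⟨k, hk, by simp⟩
        · rintro ⟨k, hk, rfl⟩
          exact ⟨Finset.mul_mem_mul hi (Finset.inv_mem_inv hk), hi, k, hk, by simp⟩
      rw [this, Finset.card_image_of_injective]
      intro a b hab
      simpa using hab)
  simp only [← htraj] at h
  refine h.trans (Finset.prod_le_pow_card _ _ _ fun g _ => ?_)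
  exact (trajectory_ncard_mono α hX hX' Finset.inter_subset_right).trans
    (trajectory_translate_ncard_le α hX K g)

open Classical in
-- The product `F * K⁻¹` consists of points of `F` and points of the differences `F k⁻¹ \ F`, which
-- the Følner ratios count.
theorem card_mul_inv_le (F K : Finset G) (hF : F.Nonempty) :
    ((F * K⁻¹).card : ℝ) ≤ F.card * (1 + ∑ k ∈ K, folnerRatio k⁻¹ F) := by
  have hpos : (0 : ℝ) < F.card := by exact_mod_cast hF.card_pos
  have hsub : F * K⁻¹ ⊆ F ∪ K.biUnion fun k => F.image (fun x => x * k⁻¹) \ F := by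
    intro x hx
    obtain ⟨f, hf, k, hk, rfl⟩ := Finset.mem_mul.1 hx
    obtain ⟨l, hl, rfl⟩ := Finset.mem_inv.1 hk
    by_cases h : f * l⁻¹ ∈ F
    · exact Finset.mem_union_left _ h
    · exact Finset.mem_union_right _ (Finset.mem_biUnion.2
        ⟨l, hl, Finset.mem_sdiff.2 ⟨Finset.mem_image_of_mem _ hf, h⟩⟩)
  have h1 := (Finset.card_le_card hsub).trans ((Finset.card_union_le _ _).trans
    (Nat.add_le_add_left Finset.card_biUnion_le _))
  have h2 : (F.card : ℝ) * (1 + ∑ k ∈ K, folnerRatio k⁻¹ F) =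
      F.card + ∑ k ∈ K, ((F.image (fun x => x * k⁻¹) \ F).card : ℝ) := by
    rw [mul_add, mul_one, Finset.mul_sum]
    congr 1
    refine Finset.sum_congr rfl fun k _ => ?_
    rw [folnerRatio, mul_div_cancel₀ _ hpos.ne']
  rw [h2]
  exact_mod_cast h1

/-- The rate over a finite set is bounded by the rate over any other finite set, up to a factor
that measures almost invariance. -/
theorem trajectoryRate_le {X : Set A} (hX : X.Finite) (hX' : X.Nonempty) (F K : Finset G)
    (hF : F.Nonempty) (hK : K.Nonempty) :
    trajectoryRate α X F ≤ (1 + ∑ k ∈ K, folnerRatio k⁻¹ F) * trajectoryRate α X K := by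
  classical
  have hFpos : (0 : ℝ) < F.card := by exact_mod_cast hF.card_pos
  have hKpos : (0 : ℝ) < K.card := by exact_mod_cast hK.card_pos
  have h1 : ((trajectory α F X).ncard : ℝ) ^ K.card ≤
      ((trajectory α K X).ncard : ℝ) ^ (F * K⁻¹).card := by
    exact_mod_cast trajectory_ncard_pow_le α hX hX' F K hK
  have h2 := Real.log_le_log (by
    have := trajectory_ncard_pos α hX hX' F
    positivity) h1
  rw [Real.log_pow, Real.log_pow] at h2
  have h3 := h2.trans (mul_le_mul_of_nonneg_right (card_mul_inv_le F K hF)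
    (Real.log_natCast_nonneg _))
  rw [trajectoryRate, trajectoryRate, div_le_iff₀ hFpos, mul_div_assoc', div_mul_eq_mul_div,
    le_div_iff₀ hKpos]
  linarith

/-- Along right Følner nets the rates converge to their infimum. -/
theorem tendsto_trajectoryRate {X : Set A} (hX : X.Finite) (hX' : X.Nonempty) :
    Tendsto (trajectoryRate α X) (rightFolner G)
      (𝓝 (⨅ K : {K : Finset G // K.Nonempty}, trajectoryRate α X K)) := by
  have hbdd : BddBelow (Set.range fun K : {K : Finset G // K.Nonempty} =>
      trajectoryRate α X K) := ⟨0, by rintro _ ⟨K, rfl⟩; exact trajectoryRate_nonneg α X _⟩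
  have hne : ∀ᶠ F in rightFolner G, F.Nonempty :=
    mem_inf_of_left (mem_principal_self _)
  have : Nonempty {K : Finset G // K.Nonempty} := ⟨⟨{1}, by simp⟩⟩
  have hratio : ∀ s : G, Tendsto (folnerRatio s) (rightFolner G) (𝓝 0) := fun s =>
    tendsto_comap.mono_left (inf_le_right.trans (iInf_le _ s))
  -- The lower bound is the definition of the infimum. For the upper bound, fix a `K` with rate
  -- below `a`; the error factor in `trajectoryRate_le` tends to 1 for this fixed `K`.
  refine tendsto_order.2 ⟨fun a ha => ?_, fun a ha => ?_⟩
  · filter_upwards [hne] with F hF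
    exact ha.trans_le (ciInf_le hbdd ⟨F, hF⟩)
  · obtain ⟨⟨K, hK⟩, hKa⟩ := exists_lt_of_ciInf_lt ha
    have hlim : Tendsto (fun F => (1 + ∑ k ∈ K, folnerRatio k⁻¹ F) * trajectoryRate α X K)
        (rightFolner G) (𝓝 ((1 + ∑ k ∈ K, 0) * trajectoryRate α X K)) :=
      (tendsto_const_nhds.add (tendsto_finsetSum _ fun k _ => hratio k⁻¹)).mul_const _
    have hlt : (1 + ∑ k ∈ K, 0) * trajectoryRate α X K < a := by simpa using hKa
    filter_upwards [hne, hlim.eventually_lt_const hlt] with F hF hFa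
    exact (trajectoryRate_le α hX hX' F K hF hK).trans_lt hFa

theorem IsRightAmenable.Halg_eq (hG : IsRightAmenable G) {X : Set A} (hX : X.Finite)
    (hX' : X.Nonempty) :
    Halg α X = ⨅ K : {K : Finset G // K.Nonempty}, trajectoryRate α X K :=
  have := hG.rightFolner_neBot
  (tendsto_trajectoryRate α hX hX').limUnder_eq

theorem IsRightAmenable.halgWellDefined (hG : IsRightAmenable G) : HalgWellDefined α :=
  ⟨hG.rightFolner_neBot, fun X hX hX' => by
    rw [hG.Halg_eq α hX hX']
    exact tendsto_trajectoryRate α hX hX'⟩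

theorem IsRightAmenable.Halg_le (hG : IsRightAmenable G) {X : Set A} (hX : X.Finite)
    (hX' : X.Nonempty) (K : Finset G) (hK : K.Nonempty) : Halg α X ≤ trajectoryRate α X K := by
  rw [hG.Halg_eq α hX hX']
  exact ciInf_le (f := fun K : {K : Finset G // K.Nonempty} => trajectoryRate α X K)
    ⟨0, by rintro _ ⟨K, rfl⟩; exact trajectoryRate_nonneg α X _⟩ ⟨K, hK⟩

end Group

/-! ### Infinite `N`: polynomial growth forces zero entropy. -/

section InfiniteKernel

variable {A : Type*} [AddCommGroup A]

/-- Iterated sumsets in an abelian group grow polynomially. -/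
theorem ncard_sum_const_le {ι : Type*} (K : Finset ι) (X : Finset A) :
    (∑ _i ∈ K, (X : Set A)).ncard ≤ (K.card + 1) ^ X.card := by
  classical
  have hsub : (∑ _i ∈ K, (X : Set A)) ⊆
      Set.range fun c : X → Fin (K.card + 1) => ∑ a : X, (c a : ℕ) • (a : A) := by
    intro t ht
    obtain ⟨x, hx, rfl⟩ := (Set.mem_finsetSum ..).1 ht
    -- By commutativity a sum depends only on how often each `a ∈ X` occurs, a number between 0 and
    -- `|K|`.
    refine ⟨fun a => ⟨(K.filter fun i => x i = a).card,
      Nat.lt_succ_of_le (Finset.card_filter_le _ _)⟩, ?_⟩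
    simp only
    rw [Finset.sum_coe_sort X fun a => (K.filter fun i => x i = a).card • a,
      ← Finset.sum_fiberwise_of_maps_to' (t := X) (fun i hi => hx hi) (fun a => a)]
    simp
  refine (Set.ncard_le_ncard hsub (Set.finite_range _)).trans ?_
  rw [← Set.image_univ]
  refine (Set.ncard_image_le Set.finite_univ).trans ?_
  simp [Set.ncard_univ]

theorem trajectory_of_le_ker {G : Type*} [Group G] (α : G →* AddMonoid.End A) (X : Set A)
    (K : Finset G) (hK : ∀ k ∈ K, k ∈ α.ker) : trajectory α K X = ∑ _k ∈ K, X := by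
  refine Finset.sum_congr rfl fun k hk => ?_
  rw [MonoidHom.mem_ker.1 (hK k hk)]
  simp

theorem IsRightAmenable.Halg_eq_zero {G : Type*} [Group G] (hG : IsRightAmenable G)
    (α : G →* AddMonoid.End A) (N : Subgroup G) (hN : N ≤ α.ker) [Infinite N] {X : Set A}
    (hX : X.Finite) (hX' : X.Nonempty) : Halg α X = 0 := by
  refine le_antisymm ?_ ?_
  · lift X to Finset A using hX
    -- The denominator `1 * (n + 1) + -1` is `n`: this is the limit of `log x / (x - 1)` taken at `x
    -- = n + 1`.
    have hlim : Tendsto (fun n : ℕ => (X.card : ℝ) *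
        (Real.log ((n : ℝ) + 1) ^ 1 / (1 * ((n : ℝ) + 1) + -1))) atTop (𝓝 ((X.card : ℝ) * 0)) :=
      ((Real.tendsto_pow_log_div_mul_add_atTop 1 (-1) 1 one_ne_zero).comp
        (tendsto_atTop_add_const_right _ (1 : ℝ) tendsto_natCast_atTop_atTop)).const_mul _
    rw [mul_zero] at hlim
    refine ge_of_tendsto hlim ?_
    filter_upwards [eventually_gt_atTop 0] with n hn
    obtain ⟨K, hK⟩ := Infinite.exists_subset_card_eq N n
    set K' : Finset G := K.map ⟨Subtype.val, Subtype.val_injective⟩ with hK'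
    have hcard : K'.card = n := by rw [hK', Finset.card_map, hK]
    have hmem : ∀ k ∈ K', k ∈ α.ker := by
      intro k hk
      obtain ⟨l, _, rfl⟩ := Finset.mem_map.1 hk
      exact hN l.2
    have hne : K'.Nonempty := Finset.card_pos.1 (by omega)
    refine (hG.Halg_le α X.finite_toSet hX' K' hne).trans ?_
    have h1 := ncard_sum_const_le K' X
    rw [← trajectory_of_le_ker α X K' hmem, hcard] at h1
    have h2 : Real.log ((trajectory α K' (X : Set A)).ncard : ℝ) ≤
        X.card * Real.log ((n : ℝ) + 1) := by
      rw [← Real.log_pow]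
      refine Real.log_le_log ?_ (by exact_mod_cast h1)
      exact_mod_cast trajectory_ncard_pos α X.finite_toSet hX' K'
    rw [trajectoryRate, hcard]
    have : (1 : ℝ) * ((n : ℝ) + 1) + -1 = n := by ring
    rw [this, pow_one, mul_div_assoc']
    gcongr
  · rw [hG.Halg_eq α hX hX']
    exact Real.iInf_nonneg fun K => trajectoryRate_nonneg α X _

end InfiniteKernel

/-! ### Finite `N`: pulling Følner sets back from the quotient. -/

section FiniteKernel

variable {G A : Type*} [Group G] [AddCommGroup A] (N : Subgroup G)

theorem QuotientGroup.finite_preimage_mk [Finite N] (F : Finset (G ⧸ N)) :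
    ((QuotientGroup.mk : G → G ⧸ N) ⁻¹' (F : Set (G ⧸ N))).Finite := by
  refine F.finite_toSet.preimage' fun b _ => ?_
  have h := QuotientGroup.card_preimage_mk N {b}
  have : Finite ((QuotientGroup.mk : G → G ⧸ N) ⁻¹' {b}) :=
    Nat.finite_of_card_ne_zero (by rw [h]; simp [Nat.card_pos.ne'])
  exact Set.toFinite _

/-- The preimage of a finite subset of `G ⧸ N` for finite `N`. -/
noncomputable def quotientPreimage [Finite N] (F : Finset (G ⧸ N)) : Finset G :=
  (QuotientGroup.finite_preimage_mk N F).toFinset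

variable {N}

@[simp]
theorem mem_quotientPreimage [Finite N] {F : Finset (G ⧸ N)} {g : G} :
    g ∈ quotientPreimage N F ↔ (g : G ⧸ N) ∈ F := by
  simp [quotientPreimage]

theorem card_quotientPreimage [Finite N] (F : Finset (G ⧸ N)) :
    (quotientPreimage N F).card = Nat.card N * F.card := by
  have h := QuotientGroup.card_preimage_mk N (F : Set (G ⧸ N))
  rw [Nat.card_coe_set_eq, Nat.card_coe_set_eq, Set.ncard_coe_finset] at h
  rw [← h, quotientPreimage,
    ← Set.ncard_eq_toFinset_card _ (QuotientGroup.finite_preimage_mk N F)]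

variable [N.Normal]

/-- Taking preimages commutes with right translation and with set difference, and multiplies every
cardinality by `|N|`, which cancels in the ratio. -/
theorem folnerRatio_quotientPreimage [Finite N] (s : G) (F : Finset (G ⧸ N)) :
    folnerRatio s (quotientPreimage N F) = folnerRatio (s : G ⧸ N) F := by
  classical
  have h : (quotientPreimage N F).image (fun x => x * s) \ quotientPreimage N F =
      quotientPreimage N (F.image (fun x => x * (s : G ⧸ N)) \ F) := by
    ext g
    simp only [Finset.mem_sdiff, Finset.mem_image, mem_quotientPreimage]
    refine and_congr_left fun _ => ⟨?_, ?_⟩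
    · rintro ⟨x, hx, rfl⟩
      exact ⟨x, hx, rfl⟩
    · rintro ⟨q, hq, h⟩
      refine ⟨g * s⁻¹, ?_, by simp⟩
      rw [QuotientGroup.mk_mul, QuotientGroup.mk_inv, ← h]
      simpa using hq
  have hN : (Nat.card N : ℝ) ≠ 0 := by exact_mod_cast Nat.card_pos.ne'
  have h' := congrArg Finset.card h
  rw [card_quotientPreimage] at h'
  replace h' := congrArg (Nat.cast : ℕ → ℝ) h'
  rw [Nat.cast_mul] at h'
  unfold folnerRatio
  rw [card_quotientPreimage]
  rw [Nat.cast_mul, ← mul_div_mul_left _ (F.card : ℝ) hN, ← Nat.cast_mul]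
  congr 1
  refine h'.trans ?_
  congr!

theorem tendsto_quotientPreimage [Finite N] :
    Tendsto (quotientPreimage N) (rightFolner (G ⧸ N)) (rightFolner G) := by
  refine tendsto_inf.2 ⟨tendsto_principal.2 ?_, tendsto_iInf.2 fun s => tendsto_comap_iff.2 ?_⟩
  · filter_upwards [mem_inf_of_left (mem_principal_self _)] with F hF
    refine Finset.card_pos.1 ?_
    rw [card_quotientPreimage]
    exact Nat.mul_pos Nat.card_pos (Finset.Nonempty.card_pos hF)
  · have : folnerRatio s ∘ quotientPreimage N = folnerRatio (s : G ⧸ N) :=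
      funext fun F => folnerRatio_quotientPreimage s F
    rw [this]
    exact tendsto_comap.mono_left (inf_le_right.trans (iInf_le _ _))

/-- The `|N|` elements of a coset act by the same endomorphism, whose additivity turns their joint
contribution into the image of an `|N|`-fold sumset. -/
theorem trajectory_quotientPreimage [Finite N] (α : G →* AddMonoid.End A) (hN : N ≤ α.ker)
    (X : Set A) (F : Finset (G ⧸ N)) :
    trajectory α (quotientPreimage N F) X =
      trajectory (quotientAction α N hN) F (∑ _i ∈ Finset.range (Nat.card N), X) := by
  classical
  rw [trajectory, trajectory, ← Finset.sum_fiberwise_of_maps_to (t := F)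
    (g := (QuotientGroup.mk : G → G ⧸ N)) (fun g hg => mem_quotientPreimage.1 hg)]
  refine Finset.sum_congr rfl fun q hq => ?_
  have hfib : (quotientPreimage N F).filter (fun g : G => (g : G ⧸ N) = q) =
      quotientPreimage N {q} := by
    ext g
    simp only [Finset.mem_filter, mem_quotientPreimage, Finset.mem_singleton]
    exact ⟨fun h => h.2, fun h => ⟨h ▸ hq, h⟩⟩
  have hterm : ∀ g ∈ quotientPreimage N {q}, (fun a => α g a) '' X =
      (fun a => quotientAction α N hN q a) '' X := by
    intro g hg
    rw [mem_quotientPreimage, Finset.mem_singleton] at hg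
    subst hg
    rfl
  rw [hfib, Finset.sum_congr rfl hterm, Set.image_finsetSum, Finset.sum_const, Finset.sum_const,
    card_quotientPreimage, Finset.card_range, Finset.card_singleton, mul_one]

theorem sum_const_finite {n : ℕ} {X : Set A} (hX : X.Finite) :
    (∑ _i ∈ Finset.range n, X).Finite := by
  induction n with
  | zero => simp
  | succ n ih =>
    rw [Finset.sum_range_succ]
    exact ih.add hX

theorem sum_const_nonempty {n : ℕ} {X : Set A} (hX : X.Nonempty) :
    (∑ _i ∈ Finset.range n, X).Nonempty := by
  induction n with
  | zero => simp
  | succ n ih =>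
    rw [Finset.sum_range_succ]
    exact ih.add hX

theorem sum_const_addSubgroup (B : AddSubgroup A) {n : ℕ} (hn : n ≠ 0) :
    ∑ _i ∈ Finset.range n, (B : Set A) = B := by
  induction n, Nat.one_le_iff_ne_zero.2 hn using Nat.le_induction with
  | base => simp
  | succ n h ih =>
    rw [Finset.sum_range_succ, ih (by omega)]
    exact coe_add_coe B

/-- The limit for `α` may be computed along preimages of Følner sets of `G ⧸ N`, where the two rates
differ exactly by the factor `|N|`. -/
theorem Halg_eq_div [Finite N] (hG : IsRightAmenable G) (α : G →* AddMonoid.End A)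
    (hN : N ≤ α.ker) {X : Set A} (hX : X.Finite) (hX' : X.Nonempty) :
    Halg α X =
      Halg (quotientAction α N hN) (∑ _i ∈ Finset.range (Nat.card N), X) / Nat.card N := by
  have hQ := hG.of_surjective (QuotientGroup.mk' N) (QuotientGroup.mk'_surjective N)
  have := hQ.rightFolner_neBot
  have h1 := ((hG.halgWellDefined α).2 X hX hX').comp (tendsto_quotientPreimage (N := N))
  have h2 := ((hQ.halgWellDefined (quotientAction α N hN)).2 _ (sum_const_finite (n := Nat.card N) hX)
    (sum_const_nonempty hX')).div_const (Nat.card N : ℝ)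
  refine tendsto_nhds_unique h1 (h2.congr fun F => ?_)
  rw [Function.comp_apply, trajectoryRate, trajectoryRate, trajectory_quotientPreimage α hN,
    card_quotientPreimage, div_div, Nat.cast_mul, mul_comm]

theorem Halg_le_Halg_sum_const {H : Type*} [Group H] (hH : IsRightAmenable H)
    (β : H →* AddMonoid.End A) {X : Set A} (hX : X.Finite) (hX' : X.Nonempty) {n : ℕ}
    (hn : n ≠ 0) : Halg β X ≤ Halg β (∑ _i ∈ Finset.range n, X) := by
  have := hH.rightFolner_neBot
  refine le_of_tendsto_of_tendsto' ((hH.halgWellDefined β).2 X hX hX')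
    ((hH.halgWellDefined β).2 _ (sum_const_finite hX) (sum_const_nonempty hX')) fun F => ?_
  obtain ⟨m, rfl⟩ := Nat.exists_eq_succ_of_ne_zero hn
  -- One copy of `X` is split off; adding the non-empty trajectory of the other `m` copies cannot
  -- decrease the cardinality.
  have h : trajectory β F (∑ _i ∈ Finset.range (m + 1), X) =
      trajectory β F X + trajectory β F (∑ _i ∈ Finset.range m, X) := by
    simp only [trajectory]
    rw [← Finset.sum_add_distrib]
    refine Finset.sum_congr rfl fun s _ => ?_
    rw [Finset.sum_range_succ, add_comm, Set.image_add]
  have hle := Set.ncard_le_ncard_add (trajectory_finite β hX F)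
    (trajectory_finite β (sum_const_finite (n := m) hX) F)
    (trajectory_nonempty β (sum_const_nonempty (n := m) hX') F)
  rw [← h] at hle
  unfold trajectoryRate
  gcongr
  exact_mod_cast trajectory_ncard_pos β hX hX' F

theorem ofReal_Halg_eq_div [Finite N] (hG : IsRightAmenable G) (α : G →* AddMonoid.End A)
    (hN : N ≤ α.ker) {X : Set A} (hX : X.Finite) (hX' : X.Nonempty) :
    ENNReal.ofReal (Halg α X) =
      ENNReal.ofReal (Halg (quotientAction α N hN) (∑ _i ∈ Finset.range (Nat.card N), X)) /
        Nat.card N := by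
  rw [Halg_eq_div hG α hN hX hX', ENNReal.ofReal_div_of_pos (by exact_mod_cast Nat.card_pos),
    ENNReal.ofReal_natCast]

/-- For `≤`, the `|N|`-fold sumset of `X` is itself a competitor in the supremum for the quotient.
For `≥`, enlarging `X` to that sumset does not decrease `Halg`. -/
theorem halg_eq_div [Finite N] (hG : IsRightAmenable G) (α : G →* AddMonoid.End A)
    (hN : N ≤ α.ker) : halg α = halg (quotientAction α N hN) / Nat.card N := by
  have hQ := hG.of_surjective (QuotientGroup.mk' N) (QuotientGroup.mk'_surjective N)
  refine le_antisymm ?_ ?_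
  · refine iSup_le fun X => iSup_le fun hX => iSup_le fun hX' => ?_
    rw [ofReal_Halg_eq_div hG α hN hX hX']
    gcongr
    exact le_iSup_of_le _ (le_iSup_of_le (sum_const_finite hX)
      (le_iSup_of_le (sum_const_nonempty hX') le_rfl))
  · rw [halg]
    simp only [ENNReal.iSup_div]
    refine iSup_le fun X => iSup_le fun hX => iSup_le fun hX' => ?_
    refine le_iSup_of_le X (le_iSup_of_le hX (le_iSup_of_le hX' ?_))
    rw [ofReal_Halg_eq_div hG α hN hX hX']
    gcongr
    exact Halg_le_Halg_sum_const hQ _ hX hX' Nat.card_pos.ne'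

/-- A subgroup equals its own `|N|`-fold sumset, so the two suprema agree term by term. -/
theorem entAlg_eq_div [Finite N] (hG : IsRightAmenable G) (α : G →* AddMonoid.End A)
    (hN : N ≤ α.ker) : entAlg α = entAlg (quotientAction α N hN) / Nat.card N := by
  simp only [entAlg, ENNReal.iSup_div]
  refine iSup_congr fun B => iSup_congr fun hB => ?_
  rw [ofReal_Halg_eq_div hG α hN hB ⟨0, B.zero_mem⟩, sum_const_addSubgroup B Nat.card_pos.ne']

end FiniteKernel

theorem mainTheorem7 {G A : Type*} [Group G] [AddCommGroup A] (hG : IsAmenable G)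
    (α : G →* AddMonoid.End A) (N : Subgroup G) [N.Normal] (hN : N ≤ α.ker) :
    HalgWellDefined α ∧ HalgWellDefined (quotientAction α N hN) ∧
    (Infinite N → halg α = 0 ∧ entAlg α = 0) ∧
    (Finite N →
      halg α = halg (quotientAction α N hN) / (Nat.card N : ENNReal) ∧
      entAlg α = entAlg (quotientAction α N hN) / (Nat.card N : ENNReal)) := by
  have hR := hG.2
  have hQ := hR.of_surjective (QuotientGroup.mk' N) (QuotientGroup.mk'_surjective N)
  refine ⟨hR.halgWellDefined α, hQ.halgWellDefined _, fun _ => ⟨?_, ?_⟩, fun _ =>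
    ⟨halg_eq_div hR α hN, entAlg_eq_div hR α hN⟩⟩
  · simp only [halg, ENNReal.iSup_eq_zero]
    intro X hX hX'
    rw [hR.Halg_eq_zero α N hN hX hX', ENNReal.ofReal_zero]
  · simp only [entAlg, ENNReal.iSup_eq_zero]
    intro B hB
    rw [hR.Halg_eq_zero α N hN hB ⟨0, B.zero_mem⟩, ENNReal.ofReal_zero]
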